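/- Let $\mathcal H$ be a complex Hilbert space and $\mathcal D\subseteq\mathcal H$ a dense linear subspace. Let $\mathcal L^\dagger(\mathcal D,\mathcal H)$ be the set of all linear operators $X$ in $\mathcal H$ with domain $D(X)=\mathcal D$ and $D(X^*)\supseteq\mathcal D$; put $X^\dagger:=X^*\upharpoonright\mathcal D$, and let $\overline X$ be the closure of $X$. For $X,Y\in\mathcal L^\dagger(\mathcal D,\mathcal H)$ write $X\in L^{\rm w}(Y)$, or equivalently $Y\in R^{\rm w}(X)$, if $Y\mathcal D\subseteq D((X^\dagger)^*)$ and $X^*\mathcal D\subseteq D(Y^*)$; in this case the weak product is $X\,\Box\, Y:=(X^\dagger)^*Y\in\mathcal L^\dagger(\mathcal D,\mathcal H)$. Write $X\in L^{\rm s}(Y)$ (the strong product $X\circ Y$ is well defined) if $Y\mathcal D\subseteq D(\overline X)$ and $X^\dagger\mathcal D\subseteq D(\overline{Y^\dagger})$. If $X\in L^{\rm w}(Y)$, then $Y^\dagger\in L^{\rm w}(X^\dagger)$, so $Y^\dagger\,\Box\, X^\dagger$ is also defined. **Theorem.** Let $X,Y\in\mathcal L^\dagger(\mathcal D,\mathcal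 H)$. The following statements are equivalent: (i) $X\in L^{\rm s}(Y)$; (ii) $X\in L^{\rm w}(Y)$ and both of the following hold: - (ii$_1$) $\langle (X\,\Box\, Y)\xi, Z^\dagger\eta\rangle=\langle Y\xi,(X^\dagger\,\Box\, Z^\dagger)\eta\rangle$ for all $Z\in L^{\rm w}(X)$ and all $\xi,\eta\in\mathcal D$; - (ii$_2$) $\langle (Y^\dagger\,\Box\, X^\dagger)\xi, V\eta\rangle=\langle X^\dagger\xi,(Y\,\Box\, V)\eta\rangle$ for all $V\in R^{\rm w}(Y)$ and all $\xi,\eta\in\mathcal D$. -/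

import Mathlib

/-- `LDag D` is `𝓛†(𝓓, 𝓗)`: the linear operators `X` in `H` with domain `D(X) = D` whose
Hilbert space adjoint `X*` satisfies `D ⊆ D(X*)`. The subspace `D` is meant to be dense
(this is a hypothesis of the results); then every such `X` is closable. -/
structure LDag {H : Type*} [NormedAddCommGroup H] [InnerProductSpace ℂ H] [CompleteSpace H]
    (D : Submodule ℂ H) where
  /-- the underlying linear map `D → H` -/
  toLinearMap : D →ₗ[ℂ] H
  /-- `D ⊆ D(X*)` -/
  le_adjoint_domain : D ≤ (LinearPMap.mk D toLinearMap).adjoint.domain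

namespace LDag

variable {H : Type*} [NormedAddCommGroup H] [InnerProductSpace ℂ H] [CompleteSpace H]
  {D : Submodule ℂ H}

instance : CoeFun (LDag D) (fun _ => D → H) := ⟨fun X => X.toLinearMap⟩

/-- `X` as a partially defined operator in `H`, with domain `D`. -/
def op (X : LDag D) : H →ₗ.[ℂ] H := LinearPMap.mk D X.toLinearMap

/-- For a non-dense domain Mathlib's adjoint has the junk value `0`. -/
theorem adjoint_apply_of_not_dense' (hD : ¬ Dense (D : Set H)) (X : LDag D)
    (y : X.op.adjoint.domain) : X.op.adjoint y = 0 :=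
  LinearPMap.adjoint_apply_of_not_dense (T := X.op) hD y

/-- The defining property of the adjoint `X*`: `⟨X* y, ξ⟩ = ⟨y, X ξ⟩` for `ξ ∈ D`. -/
theorem adjoint_inner (hD : Dense (D : Set H)) (X : LDag D) (y : X.op.adjoint.domain) (ξ : D) :
    inner ℂ (X.op.adjoint y) (ξ : H) = inner ℂ (y : H) (X ξ) :=
  LinearPMap.adjoint_isFormalAdjoint (T := X.op) hD y ξ

/-- The map `X* ↾ D`. -/
noncomputable def daggerMap (X : LDag D) : D →ₗ[ℂ] H :=
  X.op.adjoint.toFun ∘ₗ Submodule.inclusion X.le_adjoint_domain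

theorem daggerMap_inner (hD : Dense (D : Set H)) (X : LDag D) (ξ η : D) :
    inner ℂ (X.daggerMap η) (ξ : H) = inner ℂ (η : H) (X ξ) :=
  adjoint_inner hD X (Submodule.inclusion X.le_adjoint_domain η) ξ

/-- The involution `X† := X* ↾ D`. -/
noncomputable def dagger (X : LDag D) : LDag D where
  toLinearMap := X.daggerMap
  le_adjoint_domain := by
    intro η hη
    by_cases hD : Dense (D : Set H)
    · refine LinearPMap.mem_adjoint_domain_of_exists η ⟨X ⟨η, hη⟩, fun ξ => ?_⟩
      have h := congrArg (starRingEnd ℂ) (daggerMap_inner hD X ⟨η, hη⟩ ξ)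
      rw [inner_conj_symm, inner_conj_symm] at h
      exact h.symm
    · refine LinearPMap.mem_adjoint_domain_of_exists η ⟨0, fun ξ => ?_⟩
      have h0 : X.daggerMap ξ = 0 := adjoint_apply_of_not_dense' hD X _
      change inner ℂ (0 : H) (ξ : H) = inner ℂ η (X.daggerMap ξ)
      rw [h0, inner_zero_left, inner_zero_right]

/-- `Lʷ(Y)`, the weak left multipliers of `Y`: those `X` with `Y D ⊆ D(X†*)` and
`X* D ⊆ D(Y*)` (on `D` the operator `X*` is `X†`). -/
def Lw (Y : LDag D) : Set (LDag D) :=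
  {X | (∀ ξ : D, Y ξ ∈ X.dagger.op.adjoint.domain) ∧ ∀ ξ : D, X.dagger ξ ∈ Y.op.adjoint.domain}

/-- `Rʷ(X)`, the weak right multipliers of `X`. -/
def Rw (X : LDag D) : Set (LDag D) := {Y | X ∈ Lw Y}

/-- The weak product `X □ Y := X†* Y`, defined when `X ∈ Lʷ(Y)`. -/
noncomputable def weakMul (X Y : LDag D) (h : X ∈ Lw Y) : LDag D where
  toLinearMap := X.dagger.op.adjoint.toFun ∘ₗ Y.toLinearMap.codRestrict _ h.1
  le_adjoint_domain := by
    intro η hη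
    by_cases hD : Dense (D : Set H)
    · refine LinearPMap.mem_adjoint_domain_of_exists η
        ⟨Y.op.adjoint ⟨X.dagger ⟨η, hη⟩, h.2 ⟨η, hη⟩⟩, fun ξ => ?_⟩
      have h1 := adjoint_inner hD Y ⟨X.dagger ⟨η, hη⟩, h.2 ⟨η, hη⟩⟩ ξ
      have h2 := congrArg (starRingEnd ℂ)
        (adjoint_inner hD X.dagger ⟨Y ξ, h.1 ξ⟩ ⟨η, hη⟩)
      rw [inner_conj_symm, inner_conj_symm] at h2
      exact h1.trans h2.symm
    · refine LinearPMap.mem_adjoint_domain_of_exists η ⟨0, fun ξ => ?_⟩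
      have h0 : X.dagger.op.adjoint ⟨Y ξ, h.1 ξ⟩ = 0 := adjoint_apply_of_not_dense' hD X.dagger _
      change inner ℂ (0 : H) (ξ : H) = inner ℂ η (X.dagger.op.adjoint ⟨Y ξ, h.1 ξ⟩)
      rw [h0, inner_zero_left, inner_zero_right]

/-- `Lˢ(Y)`, the strong left multipliers of `Y`: those `X` for which the strong product
`X ∘ Y` is well defined, i.e. `Y D ⊆ D(closure X)` and `X† D ⊆ D(closure Y†)`. -/
def Ls (Y : LDag D) : Set (LDag D) :=
  {X | (∀ ξ : D, Y ξ ∈ X.op.closure.domain) ∧ ∀ ξ : D, X.dagger ξ ∈ Y.dagger.op.closure.domain}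

theorem dagger_dagger_apply (hD : Dense (D : Set H)) (X : LDag D) (ξ : D) :
    X.dagger.dagger ξ = X ξ := by
  refine hD.eq_of_inner_left ℂ fun η hη => ?_
  have h1 : inner ℂ (X.dagger.dagger ξ) η = inner ℂ (ξ : H) (X.dagger ⟨η, hη⟩) :=
    daggerMap_inner hD X.dagger ⟨η, hη⟩ ξ
  have h2 := congrArg (starRingEnd ℂ) (daggerMap_inner hD X ξ ⟨η, hη⟩)
  rw [inner_conj_symm, inner_conj_symm] at h2
  exact h1.trans h2

theorem dagger_dagger (hD : Dense (D : Set H)) (X : LDag D) : X.dagger.dagger = X := by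
  cases X with
  | mk f hf =>
    have h : (LDag.mk f hf).dagger.dagger.toLinearMap = f :=
      LinearMap.ext fun ξ => dagger_dagger_apply hD ⟨f, hf⟩ ξ
    generalize (LDag.mk f hf).dagger.dagger = W at h
    cases W
    cases h
    rfl

/-- `X ∈ Lʷ(Y)` implies `Y† ∈ Lʷ(X†)`, so that `Y† □ X†` is defined whenever `X □ Y` is. -/
theorem dagger_mem_Lw (hD : Dense (D : Set H)) {X Y : LDag D} (h : X ∈ Lw Y) :
    Y.dagger ∈ Lw X.dagger := by
  refine ⟨?_, ?_⟩
  · rw [dagger_dagger hD]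
    exact h.2
  · rw [dagger_dagger hD]
    exact h.1

/-- Elements of `LDag D` are closable when `D` is dense, so that `X.op.closure` is the genuine
closure of `X` (its graph is the closure of the graph of `X`). -/
theorem op_isClosable (hD : Dense (D : Set H)) (X : LDag D) : X.op.IsClosable := by
  refine (LinearPMap.adjoint_isClosed (T := X.dagger.op) hD).isClosable.leIsClosable ?_
  refine LinearPMap.IsFormalAdjoint.le_adjoint (T := X.dagger.op) hD ?_
  exact fun η ξ => daggerMap_inner hD X ξ η

end LDag

/-! Since $\overline X=X^{**}$ and $\overline X\subseteq X^{\dagger*}$, a vector $x\in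
D(X^{\dagger*})$ lies in $D(\overline X)$ iff $\langle X^{\dagger*}x,w\rangle=\langle x,X^*w\rangle$
for all $w\in D(X^*)$ (`mem_closure_domain_iff`). Condition (ii$_1$) is this relation for $x=Y\xi$,
$w=Z^\dagger\eta$. Such $w$ exhaust $D(X^*)$ up to scalars, because rank-one $Z$ are allowed
(`forall_mem_closure_domain_iff`). Condition (ii$_2$) is (ii$_1$) for the pair
$(Y^\dagger,X^\dagger)$. -/

/-- A pair lies in the closure of the graph of a densely defined operator `T` exactly when it
satisfies the adjoint relation against all of `D(T*)`. -/
theorem LinearPMap.mem_closure_graph_iff {𝕜 E F : Type*} [RCLike 𝕜] [NormedAddCommGroup E]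
    [InnerProductSpace 𝕜 E] [NormedAddCommGroup F] [InnerProductSpace 𝕜 F] [CompleteSpace E]
    [CompleteSpace F] {T : E →ₗ.[𝕜] F} (hT : Dense (T.domain : Set E)) (x : E) (y : F) :
    (x, y) ∈ T.graph.topologicalClosure ↔
      ∀ w : T.adjoint.domain, inner 𝕜 y (w : F) = inner 𝕜 x (T.adjoint w) := by
  constructor
  · intro hxy w
    have hclosed : _root_.IsClosed {p : E × F | inner 𝕜 p.2 (w : F) = inner 𝕜 p.1 (T.adjoint w)} :=
      isClosed_eq (by fun_prop) (by fun_prop)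
    refine closure_minimal (fun p hp => ?_) hclosed hxy
    obtain ⟨ξ, h1, h2⟩ := (LinearPMap.mem_graph_iff T).1 hp
    change inner 𝕜 p.2 (w : F) = inner 𝕜 p.1 (T.adjoint w)
    rw [← h1, ← h2]
    exact (LinearPMap.adjoint_isFormalAdjoint hT).symm ξ w
  · intro h
    -- The graph is moved to the $\ell^2$ product, a Hilbert space inducing the same topology, where
    -- closure is the double orthogonal complement.
    let K : Submodule 𝕜 (WithLp 2 (E × F)) :=
      T.graph.map (WithLp.linearEquiv 2 𝕜 (E × F)).symm.toLinearMap
    have hK : WithLp.toLp 2 (x, y) ∈ K.topologicalClosure := by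
      rw [← Submodule.orthogonal_orthogonal_eq_closure, Submodule.mem_orthogonal']
      intro v hv
      have hv' : ∀ ξ : T.domain,
          inner 𝕜 (ξ : E) v.fst + inner 𝕜 (T ξ) v.snd = 0 := fun ξ =>
        (Submodule.mem_orthogonal K v).1 hv _ (Submodule.mem_map_of_mem (T.mem_graph ξ))
      -- Orthogonality of `v` to the graph says that $T^*$ sends `v.snd` to `-v.fst`.
      have hadj : ∀ ξ : T.domain, inner 𝕜 (-v.fst) (ξ : E) = inner 𝕜 v.snd (T ξ) := by
        intro ξ
        rw [← inner_conj_symm, ← inner_conj_symm v.snd, inner_neg_right,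
          neg_eq_of_add_eq_zero_right (hv' ξ)]
      have hmem := LinearPMap.mem_adjoint_domain_of_exists v.snd ⟨_, hadj⟩
      have h1 := h ⟨v.snd, hmem⟩
      rw [LinearPMap.adjoint_apply_eq hT ⟨v.snd, hmem⟩ hadj, inner_neg_right] at h1
      change inner 𝕜 x v.fst + inner 𝕜 y v.snd = 0
      rw [h1, add_neg_cancel]
    have hmaps : Set.MapsTo (WithLp.ofLp (p := 2) (V := E × F)) K T.graph := by
      rintro _ ⟨p, hp, rfl⟩
      exact hp
    have himage := map_mem_closure (WithLp.prod_continuous_ofLp 2 E F) hK hmaps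
    exact himage

namespace LDag

/-- `D(closure X)` consists of those `x ∈ D(X†*)` which satisfy the adjoint relation against all
of `D(X*)`. -/
theorem mem_closure_domain_iff {H : Type*} [NormedAddCommGroup H] [InnerProductSpace ℂ H]
    [CompleteSpace H] {D : Submodule ℂ H} (hD : Dense (D : Set H)) (X : LDag D) (x : H) :
    x ∈ X.op.closure.domain ↔ ∃ hx : x ∈ X.dagger.op.adjoint.domain,
      ∀ w : X.op.adjoint.domain,
        inner ℂ (X.dagger.op.adjoint ⟨x, hx⟩) (w : H) = inner ℂ x (X.op.adjoint w) := by
  have hgraph := (op_isClosable hD X).graph_closure_eq_closure_graph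
  constructor
  · intro hx
    have hadj : ∀ w : X.op.adjoint.domain,
        inner ℂ (X.op.closure ⟨x, hx⟩) (w : H) = inner ℂ x (X.op.adjoint w) := by
      refine (LinearPMap.mem_closure_graph_iff (T := X.op) hD x _).1 ?_
      rw [hgraph]
      exact X.op.closure.mem_graph ⟨x, hx⟩
    -- Testing only against $w\in D$ identifies $\overline X x$ as $X^{\dagger*}x$.
    have hadj' : ∀ ξ : D, inner ℂ (X.op.closure ⟨x, hx⟩) (ξ : H) = inner ℂ x (X.dagger ξ) :=
      fun ξ => hadj (Submodule.inclusion X.le_adjoint_domain ξ)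
    have hx' : x ∈ X.dagger.op.adjoint.domain :=
      LinearPMap.mem_adjoint_domain_of_exists x ⟨_, hadj'⟩
    refine ⟨hx', fun w => ?_⟩
    rw [LinearPMap.adjoint_apply_eq (T := X.dagger.op) hD ⟨x, hx'⟩ hadj']
    exact hadj w
  · rintro ⟨hx, h⟩
    have hmem := (LinearPMap.mem_closure_graph_iff (T := X.op) hD x _).2 h
    rw [hgraph] at hmem
    exact LinearPMap.mem_domain_of_mem_graph hmem

/-- The restriction to `D` of a bounded operator on `H`. -/
noncomputable def ofCLM {H : Type*} [NormedAddCommGroup H] [InnerProductSpace ℂ H]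
    [CompleteSpace H] (D : Submodule ℂ H) (A : H →L[ℂ] H) : LDag D where
  toLinearMap := A.toLinearMap ∘ₗ D.subtype
  le_adjoint_domain η _ := LinearPMap.mem_adjoint_domain_of_exists η
    ⟨A.adjoint η, fun ξ => A.adjoint_inner_left (ξ : H) η⟩

theorem mem_ofCLM_adjoint_domain {H : Type*} [NormedAddCommGroup H] [InnerProductSpace ℂ H]
    [CompleteSpace H] (D : Submodule ℂ H) (A : H →L[ℂ] H) (x : H) :
    x ∈ (ofCLM D A).op.adjoint.domain :=
  LinearPMap.mem_adjoint_domain_of_exists x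
    ⟨A.adjoint x, fun ξ => A.adjoint_inner_left (ξ : H) x⟩

theorem dagger_ofCLM_apply {H : Type*} [NormedAddCommGroup H] [InnerProductSpace ℂ H]
    [CompleteSpace H] {D : Submodule ℂ H} (hD : Dense (D : Set H)) (A : H →L[ℂ] H) (η : D) :
    (ofCLM D A).dagger η = A.adjoint η :=
  LinearPMap.adjoint_apply_eq (T := (ofCLM D A).op) hD _
    fun ξ => A.adjoint_inner_left (ξ : H) (η : H)

theorem dagger_ofCLM {H : Type*} [NormedAddCommGroup H] [InnerProductSpace ℂ H]
    [CompleteSpace H] {D : Submodule ℂ H} (hD : Dense (D : Set H)) (A : H →L[ℂ] H) :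
    (ofCLM D A).dagger = ofCLM D A.adjoint := by
  have h : (ofCLM D A).dagger.toLinearMap = (ofCLM D A.adjoint).toLinearMap :=
    LinearMap.ext fun η => dagger_ofCLM_apply hD A η
  generalize (ofCLM D A).dagger = V at h
  generalize ofCLM D A.adjoint = W at h
  cases V
  cases W
  cases h
  rfl

/-- The membership proof depends on the operators, so $X^{\dagger\dagger}=X$ cannot simply be
rewritten inside a weak product. -/
theorem weakMul_congr {H : Type*} [NormedAddCommGroup H] [InnerProductSpace ℂ H]
    [CompleteSpace H] {D : Submodule ℂ H} {X X' Y Y' : LDag D} (hX : X = X') (hY : Y = Y')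
    (h : X ∈ Lw Y) (h' : X' ∈ Lw Y') (ξ : D) : X.weakMul Y h ξ = X'.weakMul Y' h' ξ := by
  subst hX
  subst hY
  rfl

theorem adjoint_congr {H : Type*} [NormedAddCommGroup H] [InnerProductSpace ℂ H]
    [CompleteSpace H] {D : Submodule ℂ H} {X X' : LDag D} (hX : X = X') {u v : H} (huv : u = v)
    (hu : u ∈ X.op.adjoint.domain) (hv : v ∈ X'.op.adjoint.domain) :
    X.op.adjoint ⟨u, hu⟩ = X'.op.adjoint ⟨v, hv⟩ := by
  subst hX
  subst huv
  rfl

/-- `X† □ Z† = X* Z†`. -/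
theorem dagger_weakMul_dagger_apply {H : Type*} [NormedAddCommGroup H] [InnerProductSpace ℂ H]
    [CompleteSpace H] {D : Submodule ℂ H} (hD : Dense (D : Set H)) {X Z : LDag D}
    (hZ : Z ∈ Lw X) (η : D) :
    X.dagger.weakMul Z.dagger (dagger_mem_Lw hD hZ) η = X.op.adjoint ⟨Z.dagger η, hZ.2 η⟩ :=
  adjoint_congr (dagger_dagger hD X) rfl _ _

/-- `Y D ⊆ D(closure X)` if and only if `X` and `Y` satisfy the associativity relation with all
weak left multipliers of `X`. -/
theorem forall_mem_closure_domain_iff {H : Type*} [NormedAddCommGroup H] [InnerProductSpace ℂ H]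
    [CompleteSpace H] {D : Submodule ℂ H} (hD : Dense (D : Set H)) {X Y : LDag D}
    (h : X ∈ Lw Y) :
    (∀ ξ : D, Y ξ ∈ X.op.closure.domain) ↔
      ∀ (Z : LDag D) (hZ : Z ∈ Lw X) (ξ η : D),
        inner ℂ (X.weakMul Y h ξ) (Z.dagger η) =
          inner ℂ (Y ξ) (X.dagger.weakMul Z.dagger (dagger_mem_Lw hD hZ) η) := by
  constructor
  · intro hY Z hZ ξ η
    obtain ⟨_, hadj⟩ := (mem_closure_domain_iff hD X (Y ξ)).1 (hY ξ)
    rw [dagger_weakMul_dagger_apply hD hZ]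
    exact hadj ⟨Z.dagger η, hZ.2 η⟩
  · intro hassoc ξ
    refine (mem_closure_domain_iff hD X (Y ξ)).2 ⟨h.1 ξ, fun w => ?_⟩
    -- The rank-one operator below needs a nonzero vector of $D$.
    by_cases hbot : D = ⊥
    · have hξ : ξ = 0 := Subtype.ext ((Submodule.mem_bot ℂ).1 (hbot ▸ ξ.2))
      have hY : Y ξ = 0 := by rw [hξ]; exact map_zero Y.toLinearMap
      have hXY : X.weakMul Y h ξ = 0 := by rw [hξ]; exact map_zero (X.weakMul Y h).toLinearMap
      change inner ℂ (X.weakMul Y h ξ) (w : H) = _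
      rw [hXY, hY, inner_zero_left, inner_zero_left]
    obtain ⟨e, he, he0⟩ := (Submodule.ne_bot_iff D).1 hbot
    -- Take $Z=A^*\upharpoonright D$, so $Z^\dagger\eta=\langle e,\eta\rangle w$. Its range lies in
    -- $D(X^*)$, and boundedness gives the other half of $Z\in L^{\rm w}(X)$.
    let A : H →L[ℂ] H := InnerProductSpace.rankOne ℂ (w : H) e
    have hZdag : ∀ η : D, (ofCLM D A.adjoint).dagger η = inner ℂ e (η : H) • (w : H) := by
      intro η
      rw [dagger_ofCLM_apply hD, ContinuousLinearMap.adjoint_adjoint]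
      exact InnerProductSpace.rankOne_apply _ _ _
    have hZ : ofCLM D A.adjoint ∈ Lw X := by
      refine ⟨fun η => ?_, fun η => ?_⟩
      · rw [dagger_ofCLM hD]
        exact mem_ofCLM_adjoint_domain D _ _
      · rw [hZdag]
        exact Submodule.smul_mem _ _ w.2
    -- At $\eta=e$ both sides carry the nonzero factor $\langle e,e\rangle$.
    have key := hassoc _ hZ ξ ⟨e, he⟩
    have happ : X.op.adjoint ⟨_, hZ.2 ⟨e, he⟩⟩ = inner ℂ e e • X.op.adjoint w := by
      rw [← LinearPMap.map_smul]
      exact adjoint_congr rfl (hZdag ⟨e, he⟩) _ _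
    rw [dagger_weakMul_dagger_apply hD hZ, happ, hZdag, inner_smul_right, inner_smul_right] at key
    exact mul_left_cancel₀ (inner_self_ne_zero.2 he0) key

end LDag

theorem mainTheorem1 {H : Type*} [NormedAddCommGroup H] [InnerProductSpace ℂ H] [CompleteSpace H]
    (D : Submodule ℂ H) (hD : Dense (D : Set H)) (X Y : LDag D) :
    X ∈ LDag.Ls Y ↔
      ∃ h : X ∈ LDag.Lw Y,
        (∀ (Z : LDag D) (hZ : Z ∈ LDag.Lw X) (ξ η : D),
          inner ℂ (X.weakMul Y h ξ) (Z.dagger η) =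
            inner ℂ (Y ξ) (X.dagger.weakMul Z.dagger (LDag.dagger_mem_Lw hD hZ) η)) ∧
        (∀ (V : LDag D) (hV : V ∈ LDag.Rw Y) (ξ η : D),
          inner ℂ (Y.dagger.weakMul X.dagger (LDag.dagger_mem_Lw hD h) ξ) (V η) =
            inner ℂ (X.dagger ξ) (Y.weakMul V hV η)) := by
  have hw : X ∈ LDag.Ls Y → X ∈ LDag.Lw Y := fun hs =>
    ⟨fun ξ => ((LDag.mem_closure_domain_iff hD X _).1 (hs.1 ξ)).1, fun ξ => by
      have h := ((LDag.mem_closure_domain_iff hD Y.dagger _).1 (hs.2 ξ)).1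
      rwa [LDag.dagger_dagger hD] at h⟩
  constructor
  · intro hs
    refine ⟨hw hs, (LDag.forall_mem_closure_domain_iff hD (hw hs)).1 hs.1, fun V hV ξ η => ?_⟩
    -- $V\in R^{\rm w}(Y)$ enters as the left multiplier $V^\dagger$ of $Y^\dagger$.
    have key := (LDag.forall_mem_closure_domain_iff hD (LDag.dagger_mem_Lw hD (hw hs))).1 hs.2
      V.dagger (LDag.dagger_mem_Lw hD hV) ξ η
    rwa [LDag.dagger_dagger_apply hD, LDag.weakMul_congr (LDag.dagger_dagger hD Y)
      (LDag.dagger_dagger hD V) _ hV] at key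
  · rintro ⟨h, h1, h2⟩
    refine ⟨(LDag.forall_mem_closure_domain_iff hD h).2 h1,
      (LDag.forall_mem_closure_domain_iff hD (LDag.dagger_mem_Lw hD h)).2 fun Z hZ ξ η => ?_⟩
    have hV : Z.dagger ∈ LDag.Rw Y := by
      have h' := LDag.dagger_mem_Lw hD hZ
      rwa [LDag.dagger_dagger hD] at h'
    rw [LDag.weakMul_congr (LDag.dagger_dagger hD Y) rfl _ hV]
    exact h2 Z.dagger hV ξ η
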